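/- Theorem 2 (Generalized Gerstenhaber theorem). Let $K$ be an arbitrary field, $n \geq 0$ an integer, and $V$ a linear subspace of the space $M_n(K)$ of $n \times n$ matrices over $K$ with trivial spectrum, meaning that no matrix in $V$ has a non-zero eigenvalue in $K$. Then $$\dim V \leq \frac{n(n-1)}{2}.$$ If equality holds, $K$ has at least $3$ elements, and $V$ is irreducible, meaning that no linear subspace of $K^n$ other than $\{0\}$ and $K^n$ is invariant under all the elements of $V$, then $V = P\,A_n(K)$ for some invertible matrix $P \in \mathrm{GL}_n(K)$, where $A_n(K)$ is the space of alternating $n \times n$ matrices (skew-symmetric with zero diagonal). -/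

import Mathlib

namespace TrivialSpectrum

/-- A linear subspace `V` of `n × n` matrices over `K` has trivial spectrum if no matrix in `V`
has a non-zero eigenvalue in `K`. -/
def HasTrivialSpectrum {K : Type*} [Field K] {n : ℕ}
    (V : Submodule K (Matrix (Fin n) (Fin n) K)) : Prop :=
  ∀ N ∈ V, ∀ c : K, Module.End.HasEigenvalue (Matrix.toLin' N) c → c = 0

/-- A linear subspace `V` of `n × n` matrices is irreducible if no proper non-zero linear
subspace of `K ^ n` is invariant under all the elements of `V`. -/
def IsIrreducible {K : Type*} [Field K] {n : ℕ}
    (V : Submodule K (Matrix (Fin n) (Fin n) K)) : Prop :=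
  ∀ W : Submodule K (Fin n → K),
    (∀ N ∈ V, ∀ x ∈ W, Matrix.mulVec N x ∈ W) → W = ⊥ ∨ W = ⊤

/-- The space of alternating `n × n` matrices over `K`: skew-symmetric with zero diagonal
(the second condition matters in characteristic two). -/
def alternatingMatrices (n : ℕ) (K : Type*) [Field K] :
    Submodule K (Matrix (Fin n) (Fin n) K) where
  carrier := {A | A.transpose = -A ∧ ∀ i, A i i = 0}
  zero_mem' := by simp
  add_mem' := by
    rintro A B ⟨hA, hA'⟩ ⟨hB, hB'⟩
    refine ⟨?_, fun i => by simp [hA' i, hB' i]⟩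
    rw [Matrix.transpose_add, hA, hB, neg_add]
  smul_mem' := by
    rintro c A ⟨hA, hA'⟩
    refine ⟨?_, fun i => by simp [hA' i]⟩
    rw [Matrix.transpose_smul, hA, smul_neg]

end TrivialSpectrum

/-! A vector `x` is adapted when no non-zero operator of `V` has its range in `Kx`. A digraph
argument shows that the other vectors span a proper subspace. For adapted `x`, the orbit `Vx` misses
`x`, so it has dimension at most `n - 1`. The operators of `V` killing `x` embed in `End (E/Kx)`,
again without fixed vectors. Induction gives the bound.

In the equality case it suffices to find a nondegenerate `b` with `b(y, Ny) = 0` for all `N` in `V`.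
Left multiplication by its matrix then carries `V` into the alternating matrices, and dimensions
agree. Let `φ` have kernel `Vx` and `φ x = 1`. Up to scaling `b(x, ·) = φ`, so polarization forces
`b(y, Nx) = -φ(Ny)`. Thus `b = B + Λ ⊗ φ`, where `B(y, x) = 0`.

For `y` off a proper subspace, counting dimensions on the pairs `(Nx, Ny)` yields a candidate for
`b(y, ·)`; this uses a scalar other than 0 and 1. A second count shows that the right radical of `B`
in `ker φ` is invariant, hence zero. Then every `y` has a candidate, and the coefficients of `φ` can
be taken linear in `y`. -/

namespace TrivialSpectrum

open Module

section

variable {K E : Type*} [Field K] [AddCommGroup E] [Module K E]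

/-! ### Adapted vectors -/

/-- A finite digraph without sinks contains a nonempty set of vertices in which every vertex has
exactly one successor. -/
theorem exists_finset_existsUnique_succ {ι : Type*} [Finite ι] [Nonempty ι] (r : ι → ι → Prop)
    (h : ∀ i, ∃ j, r i j) :
    ∃ I : Finset ι, I.Nonempty ∧ ∀ i ∈ I, ∃ j ∈ I, r i j ∧ ∀ j' ∈ I, r i j' → j' = j := by
  classical
  have := Fintype.ofFinite ι
  obtain ⟨I, ⟨hI, hI'⟩, hmin⟩ := (wellFounded_lt (α := Finset ι)).has_min
    {I | I.Nonempty ∧ ∀ i ∈ I, ∃ j ∈ I, r i j}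
    ⟨Finset.univ, Finset.univ_nonempty, fun i _ => by simpa using h i⟩
  -- Otherwise erasing `i` would leave a smaller set without sinks. Since `k i` has a successor, it
  -- determines `i`, so `k` permutes `I`.
  have key : ∀ i : I, ∃ k : I, ∀ j ∈ I, r k j → j = i := by
    rintro ⟨i, hi⟩
    by_contra! hc
    refine hmin (I.erase i) ⟨?_, ?_⟩ (Finset.erase_ssubset hi)
    · obtain ⟨j, hj, -, hne⟩ := hc ⟨i, hi⟩
      exact ⟨j, by simp_all⟩
    · intro k hk
      obtain ⟨j, hj, hkj, hne⟩ := hc ⟨k, Finset.mem_of_mem_erase hk⟩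
      exact ⟨j, by simp_all, hkj⟩
  choose k hk using key
  have hinj : Function.Injective k := by
    intro i i' hii
    obtain ⟨j, hj, hr⟩ := hI' (k i) (k i).2
    have h1 := hk i j hj hr
    rw [hii] at hr
    exact Subtype.ext (h1.symm.trans (hk i' j hj hr))
  refine ⟨I, hI, fun i hi => ?_⟩
  obtain ⟨a, ha⟩ := (Finite.injective_iff_surjective.1 hinj) ⟨i, hi⟩
  obtain ⟨j, hj, hr⟩ := hI' i hi
  have hu : ∀ j' ∈ I, r i j' → j' = a := fun j' hj' hr' => hk a j' hj' (by rw [ha]; exact hr')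
  exact ⟨j, hj, hr, fun j' hj' hr' => (hu j' hj' hr').trans (hu j hj hr).symm⟩


/-- No operator in `V` has a non-zero fixed vector; for a linear subspace this is the same as
having no non-zero eigenvalue in `K`. -/
def NoFixedVector (V : Submodule K (End K E)) : Prop :=
  ∀ N ∈ V, ∀ x, N x = x → x = 0

/-- The vector `x` spans the range of no operator in `V`. -/
def IsAdapted (V : Submodule K (End K E)) (x : E) : Prop :=
  ∀ f : Dual K E, f.smulRight x ∈ V → f = 0

/-- If each `e i` spans the range of some `f i ⊗ e i` in `V`, join `i` to `j` when `f i (e j) ≠ 0`.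
On a set `I` with unique successors, every `f i` is non-zero at `x = ∑ e j`, so a rescaled sum of
these operators fixes `x`. -/
theorem NoFixedVector.exists_basis_adapted {V : Submodule K (End K E)} (hV : NoFixedVector V)
    {ι : Type*} [Finite ι] [Nonempty ι] (e : Basis ι K E) : ∃ i, IsAdapted V (e i) := by
  classical
  by_contra! hc
  simp only [IsAdapted, not_forall] at hc
  choose f hfV hf using hc
  obtain ⟨I, hI, hsucc⟩ := exists_finset_existsUnique_succ (fun i j => f i (e j) ≠ 0) (by
    intro i
    by_contra! h0
    exact hf i (e.ext (by simpa using h0)))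
  set x := ∑ j ∈ I, e j with hx
  have hfx : ∀ i ∈ I, f i x ≠ 0 := by
    intro i hi
    obtain ⟨j, hj, hij, hu⟩ := hsucc i hi
    rw [hx, map_sum, Finset.sum_eq_single j]
    · exact hij
    · intro b hb hbj
      by_contra h0
      exact hbj (hu b hb h0)
    · exact fun h => absurd hj h
  have hx0 : x = 0 := by
    refine hV (∑ i ∈ I, (f i x)⁻¹ • (f i).smulRight (e i))
      (V.sum_mem fun i _ => V.smul_mem _ (hfV i)) x ?_
    rw [LinearMap.sum_apply]
    conv_rhs => rw [hx]
    refine Finset.sum_congr rfl fun i hi => ?_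
    simp [smul_smul, inv_mul_cancel₀ (hfx i hi)]
  obtain ⟨i, hi⟩ := hI
  have := hfx i hi
  rw [hx0, map_zero] at this
  exact this rfl

theorem NoFixedVector.exists_adapted_subspace [FiniteDimensional K E] [Nontrivial E]
    {V : Submodule K (End K E)} (hV : NoFixedVector V) :
    ∃ G : Submodule K E, G ≠ ⊤ ∧ ∀ x ∉ G, IsAdapted V x := by
  refine ⟨Submodule.span K {x | ¬ IsAdapted V x}, fun htop => ?_, fun x hx => ?_⟩
  · let e := Basis.ofSpan htop.ge
    have : Finite _ := Module.Finite.finite_basis e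
    have : Nonempty _ := e.index_nonempty
    obtain ⟨i, hi⟩ := hV.exists_basis_adapted e
    exact Basis.ofSpan_subset htop.ge ⟨i, rfl⟩ hi
  · by_contra h
    exact hx (Submodule.subset_span h)

/-! ### Orbits, compressions and the dimension bound -/

theorem finrank_eq_finrank_map_add {F G : Type*} [AddCommGroup F] [Module K F]
    [FiniteDimensional K F] [AddCommGroup G] [Module K G] (f : F →ₗ[K] G) (V : Submodule K F) :
    finrank K V = finrank K (V.map f) + finrank K (V ⊓ LinearMap.ker f : Submodule K F) := by
  rw [← LinearMap.finrank_range_add_finrank_ker (f.domRestrict V), LinearMap.range_domRestrict]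
  congr 1
  rw [LinearMap.ker_domRestrict, ← Submodule.finrank_map_subtype_eq,
    Submodule.map_comap_subtype]

theorem finrank_le_of_injOn {F G : Type*} [AddCommGroup F] [Module K F]
    [AddCommGroup G] [Module K G] [FiniteDimensional K G]
    (f : F →ₗ[K] G) (V : Submodule K F) (U : Submodule K G) (hU : ∀ N ∈ V, f N ∈ U)
    (h : ∀ N ∈ V, f N = 0 → N = 0) : finrank K V ≤ finrank K U := by
  refine LinearMap.finrank_le_finrank_of_injective
    (f := (f.domRestrict V).codRestrict U fun N => hU N N.2) ?_
  rw [← LinearMap.ker_eq_bot, LinearMap.ker_eq_bot']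
  rintro ⟨N, hN⟩ h0
  exact Subtype.ext (h N hN (congrArg Subtype.val h0))

/-- The vectors `N x` for `N ∈ V`. -/
def orbit (V : Submodule K (End K E)) (x : E) : Submodule K E :=
  V.map (LinearMap.applyₗ x)

/-- The operators of `V` that annihilate `x`. -/
def annihilator (V : Submodule K (End K E)) (x : E) : Submodule K (End K E) :=
  V ⊓ LinearMap.ker (LinearMap.applyₗ x)

theorem mem_orbit {V : Submodule K (End K E)} {x y : E} :
    y ∈ orbit V x ↔ ∃ N ∈ V, N x = y := by
  simp [orbit]

theorem mem_annihilator {V : Submodule K (End K E)} {x : E} {N : End K E} :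
    N ∈ annihilator V x ↔ N ∈ V ∧ N x = 0 := by
  simp [annihilator]

theorem finrank_eq_orbit_add_annihilator [FiniteDimensional K E] (V : Submodule K (End K E))
    (x : E) : finrank K V = finrank K (orbit V x) + finrank K (annihilator V x) :=
  finrank_eq_finrank_map_add _ _

theorem NoFixedVector.notMem_orbit {V : Submodule K (End K E)} (hV : NoFixedVector V) {x : E}
    (hx : x ≠ 0) : x ∉ orbit V x := fun h => by
  obtain ⟨N, hN, h⟩ := mem_orbit.1 h
  exact hx (hV N hN x h)

/-- A linear form that vanishes on the orbit of `x` and takes the value `1` at `x`. -/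
theorem NoFixedVector.exists_dual {V : Submodule K (End K E)} (hV : NoFixedVector V) {x : E}
    (hx : x ≠ 0) : ∃ f : Dual K E, f x = 1 ∧ ∀ N ∈ V, f (N x) = 0 := by
  obtain ⟨f, hf, hle⟩ := Submodule.exists_le_ker_of_notMem (hV.notMem_orbit hx)
  refine ⟨(f x)⁻¹ • f, by simp [hf], fun N hN => ?_⟩
  have : f (N x) = 0 := hle (mem_orbit.2 ⟨N, hN, rfl⟩)
  simp [this]

theorem NoFixedVector.finrank_orbit_lt [FiniteDimensional K E] {V : Submodule K (End K E)}
    (hV : NoFixedVector V) {x : E} (hx : x ≠ 0) : finrank K (orbit V x) + 1 ≤ finrank K E := by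
  refine Submodule.finrank_lt fun h => hV.notMem_orbit hx ?_
  rw [h]
  trivial

/-- The projection onto the kernel of `φ` along `x`. -/
def projKer (φ : Dual K E) (x : E) (h : φ x = 1) : E →ₗ[K] LinearMap.ker φ :=
  (LinearMap.id - φ.smulRight x).codRestrict _ fun z => by simp [h]

/-- The operator induced by `N` on the kernel of `φ`, seen as the quotient of the whole space
by the line of `x`. -/
def compress (φ : Dual K E) (x : E) (h : φ x = 1) : End K E →ₗ[K] End K (LinearMap.ker φ) where
  toFun N := projKer φ x h ∘ₗ N ∘ₗ (LinearMap.ker φ).subtype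
  map_add' := by intros; ext; simp
  map_smul' := by intros; ext; simp

theorem coe_projKer (φ : Dual K E) (x : E) (h : φ x = 1) (z : E) :
    (projKer φ x h z : E) = z - φ z • x := rfl

theorem coe_compress_apply (φ : Dual K E) (x : E) (h : φ x = 1) (N : End K E)
    (z : LinearMap.ker φ) : (compress φ x h N z : E) = N z - φ (N z) • x := rfl

/-- If `u` is fixed modulo `x`, then `N u` is fixed by `N` because `N x = 0`. Hence `N u = 0`, and
so `u = 0`. -/
theorem NoFixedVector.map_compress {V : Submodule K (End K E)} (hV : NoFixedVector V)
    (φ : Dual K E) (x : E) (h : φ x = 1) :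
    NoFixedVector ((annihilator V x).map (compress φ x h)) := by
  rintro _ ⟨N, hN, rfl⟩ u hu
  obtain ⟨hNV, hNx⟩ := mem_annihilator.1 hN
  have hu' : N u - φ (N u) • x = u := congrArg Subtype.val hu
  have h0 : N (N u) = N u := by
    conv_rhs => rw [← hu']
    simp [hNx]
  have := hV N hNV _ h0
  ext
  rw [← hu', this]
  simp

/-- An operator killed by the compression has its range in the line of `x`, so adaptedness makes it
zero. -/
theorem IsAdapted.finrank_map_compress [FiniteDimensional K E] {V : Submodule K (End K E)}
    {x : E} (hx : IsAdapted V x) (φ : Dual K E) (h : φ x = 1) :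
    finrank K (annihilator V x) = finrank K ((annihilator V x).map (compress φ x h)) := by
  refine le_antisymm ?_ (Submodule.finrank_map_le _ _)
  refine finrank_le_of_injOn (compress φ x h) _ _
    (fun N hN => Submodule.mem_map_of_mem hN) fun N hN h0 => ?_
  obtain ⟨hNV, hNx⟩ := mem_annihilator.1 hN
  have hN' : N = (φ ∘ₗ N).smulRight x := by
    ext z
    have h1 := congrArg Subtype.val (LinearMap.congr_fun h0 (projKer φ x h z))
    rw [coe_compress_apply, coe_projKer] at h1
    simp only [map_sub, map_smul, hNx, smul_zero, sub_zero, LinearMap.zero_apply,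
      ZeroMemClass.coe_zero] at h1
    simpa using sub_eq_zero.1 h1
  have := hx (φ ∘ₗ N) (hN' ▸ hNV)
  rw [hN', this]
  ext; simp

theorem finrank_ker_dual [FiniteDimensional K E] {φ : Dual K E} {x : E} (h : φ x = 1) :
    finrank K (LinearMap.ker φ) + 1 = finrank K E :=
  Module.Dual.finrank_ker_add_one_of_ne_zero (by rintro rfl; simp at h)

/-- Twice the dimension of a space of operators without non-zero fixed vectors is at most
`n * (n - 1)`. -/
theorem NoFixedVector.two_mul_finrank_add_le [FiniteDimensional K E]
    {V : Submodule K (End K E)} (hV : NoFixedVector V) :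
    2 * finrank K V + finrank K E ≤ finrank K E * finrank K E := by
  induction hn : finrank K E generalizing E with
  | zero =>
    have := finrank_zero_iff.1 hn
    have : Subsingleton (End K E) := ⟨fun f g => by ext x; exact Subsingleton.elim _ _⟩
    simp [finrank_zero_of_subsingleton]
  | succ n ih =>
    have : Nontrivial E := nontrivial_of_finrank_pos (R := K) (by omega)
    obtain ⟨G, hG, hGV⟩ := hV.exists_adapted_subspace
    obtain ⟨x, -, hxG⟩ := SetLike.exists_of_lt (lt_top_iff_ne_top.2 hG)
    have hx0 : x ≠ 0 := by rintro rfl; exact hxG G.zero_mem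
    obtain ⟨φ, hφ, -⟩ := hV.exists_dual hx0
    have h1 := finrank_eq_orbit_add_annihilator V x
    have h2 := (hGV x hxG).finrank_map_compress φ hφ
    have h3 := hV.finrank_orbit_lt hx0
    have h4 := ih (hV.map_compress φ x hφ) (by have := finrank_ker_dual hφ; omega)
    nlinarith

/-! ### Maximal dimension and companion forms -/

/-- `V` has the maximal dimension for a space of operators without non-zero fixed vectors. -/
def HasMaximalDimension (V : Submodule K (End K E)) : Prop :=
  2 * finrank K V + finrank K E = finrank K E * finrank K E

theorem NoFixedVector.maximal_of_isAdapted [FiniteDimensional K E] {V : Submodule K (End K E)}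
    (hV : NoFixedVector V) (hmax : HasMaximalDimension V) {x : E} (hx : IsAdapted V x)
    (φ : Dual K E) (h : φ x = 1) :
    finrank K (orbit V x) + 1 = finrank K E ∧
      HasMaximalDimension ((annihilator V x).map (compress φ x h)) := by
  have hx0 : x ≠ 0 := by rintro rfl; simp at h
  have h1 := finrank_eq_orbit_add_annihilator V x
  have h2 := hx.finrank_map_compress φ h
  have h3 := hV.finrank_orbit_lt hx0
  have h4 := (hV.map_compress φ x h).two_mul_finrank_add_le
  have h5 := finrank_ker_dual h
  unfold HasMaximalDimension at *
  rw [← h5] at h3 hmax ⊢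
  constructor <;> nlinarith

theorem finrank_map_prod_eval [FiniteDimensional K E] (V : Submodule K (End K E)) (x y : E) :
    finrank K (V.map ((LinearMap.applyₗ x).prod (LinearMap.applyₗ y) : End K E →ₗ[K] E × E)) =
      finrank K (orbit V x) + finrank K (orbit (annihilator V x) y) := by
  have h1 := finrank_eq_orbit_add_annihilator V x
  have h2 := finrank_eq_orbit_add_annihilator (annihilator V x) y
  have h3 := finrank_eq_finrank_map_add
    ((LinearMap.applyₗ x).prod (LinearMap.applyₗ y) : End K E →ₗ[K] E × E) V
  rw [LinearMap.ker_prod, ← inf_assoc] at h3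
  replace h3 : finrank K V = _ + finrank K (annihilator (annihilator V x) y) := h3
  omega

/-- The vectors `x`, `y`, `x + y`, `x + s y` span four distinct lines, and each has a form vanishing
on its orbit. These give four forms on `E × E` that kill all pairs `(Nx, Ny)`, a space of
codimension at most 3. Their linear relation makes `φy (N x)` proportional to `φ (N y)`. -/
theorem NoFixedVector.exists_companion_of_finrank_le [FiniteDimensional K E]
    {V : Submodule K (End K E)} (hV : NoFixedVector V) {φ : Dual K E} {x y : E} (hφ : φ x = 1)
    (hker : ∀ z, φ z = 0 ↔ z ∈ orbit V x) (hxy : ∀ c : K, y ≠ c • x)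
    (hS : 2 * finrank K E ≤ finrank K (V.map
      ((LinearMap.applyₗ x).prod (LinearMap.applyₗ y) : End K E →ₗ[K] E × E)) + 3)
    {s : K} (hs0 : s ≠ 0) (hs1 : s ≠ 1) :
    ∃ ψ : Dual K E, ∀ N ∈ V, ψ (N y) = 0 ∧ ψ (N x) = -φ (N y) := by
  by_cases hy : ∀ N ∈ V, φ (N y) = 0
  · exact ⟨0, fun N hN => by simp [hy N hN]⟩
  push Not at hy
  obtain ⟨N₀, hN₀, hN₀y⟩ := hy
  have hφx : ∀ N ∈ V, φ (N x) = 0 := fun N hN => (hker _).2 (mem_orbit.2 ⟨N, hN, rfl⟩)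
  have hne : ∀ t : K, t ≠ 0 → x + t • y ≠ 0 := by
    intro t ht h0
    refine hxy (-t⁻¹) ?_
    have : t⁻¹ • (x + t • y) = 0 := by rw [h0, smul_zero]
    rw [smul_add, smul_smul, inv_mul_cancel₀ ht, one_smul] at this
    rw [neg_smul]
    exact eq_neg_of_add_eq_zero_right this
  obtain ⟨φy, hφy, hφyN⟩ := hV.exists_dual (x := y) (by simpa using hxy 0)
  obtain ⟨ψ₁, hψ₁, hψ₁N⟩ := hV.exists_dual (hne 1 one_ne_zero)
  obtain ⟨ψ₂, hψ₂, hψ₂N⟩ := hV.exists_dual (hne s hs0)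
  set S := V.map ((LinearMap.applyₗ x).prod (LinearMap.applyₗ y) : End K E →ₗ[K] E × E)
  let v : Fin 4 → Dual K (E × E) := ![φ ∘ₗ LinearMap.fst K E E, φy ∘ₗ LinearMap.snd K E E,
    ψ₁ ∘ₗ (LinearMap.fst K E E + LinearMap.snd K E E),
    ψ₂ ∘ₗ (LinearMap.fst K E E + s • LinearMap.snd K E E)]
  have hdep : ¬ LinearIndependent K v := by
    intro hli
    have h1 := finrank_span_eq_card hli
    have h2 : Submodule.span K (Set.range v) ≤ S.dualAnnihilator := by
      rw [Submodule.span_le]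
      rintro _ ⟨i, rfl⟩
      rw [SetLike.mem_coe, Submodule.mem_dualAnnihilator]
      rintro _ ⟨N, hN, rfl⟩
      have a1 := hψ₁N N hN
      have a2 := hψ₂N N hN
      fin_cases i
      · simpa [v] using hφx N hN
      · simpa [v] using hφyN N hN
      · simpa [v] using a1
      · simpa [v] using a2
    have h3 := Submodule.finrank_mono h2
    have h4 := Subspace.finrank_add_finrank_dualAnnihilator_eq S
    rw [finrank_prod] at h4
    simp only [Fintype.card_fin] at h1
    omega
  obtain ⟨g, hg, i₀, hi₀⟩ := Fintype.not_linearIndependent_iff.1 hdep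
  have e1 : ∀ z, g 0 * φ z + g 2 * ψ₁ z + g 3 * ψ₂ z = 0 := by
    intro z
    have := LinearMap.congr_fun hg (z, 0)
    simpa [Fin.sum_univ_four, v] using this
  have e2 : ∀ z, g 1 * φy z + g 2 * ψ₁ z + g 3 * (s * ψ₂ z) = 0 := by
    intro z
    have := LinearMap.congr_fun hg (0, z)
    simpa [Fin.sum_univ_four, v] using this
  -- Elimination of `ψ₂`.
  have e3 : ∀ z, g 1 * φy z - s * g 0 * φ z = (s - 1) * g 2 * ψ₁ z := fun z => by
    linear_combination e2 z - s * e1 z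
  have hs1' : s - 1 ≠ 0 := sub_ne_zero.2 hs1
  have hg2 : g 2 ≠ 0 := by
    intro h2
    have hg0 : g 0 = 0 := by
      have := e3 (N₀ y)
      rw [hφyN N₀ hN₀, h2] at this
      simpa [hs0, hN₀y] using this
    have hg1 : g 1 = 0 := by
      have := e3 y
      rw [hφy, h2, hg0] at this
      simpa using this
    have hg3 : g 3 = 0 := by
      have := e1 (x + s • y)
      rw [hψ₂, h2, hg0] at this
      simpa using this
    fin_cases i₀ <;> simp_all
  set c := (s - 1) * g 2 with hc
  have hc0 : c ≠ 0 := mul_ne_zero hs1' hg2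
  -- This is `e3` at `N (x + y)`, where `ψ₁` vanishes.
  have e4 : ∀ N ∈ V, g 1 * φy (N x) = s * g 0 * φ (N y) := by
    intro N hN
    have a1 := hψ₁N N hN
    simp only [one_smul, map_add] at a1
    linear_combination e3 (N x) + e3 (N y) + c * a1 + s * g 0 * hφx N hN - g 1 * hφyN N hN
  -- Otherwise `φy` kills `Vx`, so it is a multiple of `φ`; vanishing at `N₀ y`, where `φ` does not,
  -- it would be zero.
  have hg0 : g 0 ≠ 0 := by
    intro h0
    have hφyx : ∀ N ∈ V, φy (N x) = 0 := by
      intro N hN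
      have := e4 N hN
      have hg1 : g 1 ≠ 0 := by
        intro h1
        have := e3 (x + (1 : K) • y)
        rw [hψ₁, h0, h1] at this
        exact hc0 (by simpa using this.symm)
      simpa [h0, hg1] using this
    have hz : ∀ z, φy z = φ z * φy x := by
      intro z
      obtain ⟨N, hN, hNz⟩ := mem_orbit.1 ((hker (z - φ z • x)).1 (by simp [hφ]))
      have := hφyx N hN
      rw [hNz, map_sub, map_smul, smul_eq_mul] at this
      linear_combination this
    have h1 := hz (N₀ y)
    have h2 := hz y
    rw [hφyN N₀ hN₀] at h1
    rw [hφy] at h2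
    rcases mul_eq_zero.1 h1.symm with h | h
    · exact hN₀y h
    · rw [h, mul_zero] at h2
      exact one_ne_zero h2
  refine ⟨(-(g 1) / (s * g 0)) • φy, fun N hN => ⟨by simp [hφyN N hN], ?_⟩⟩
  have := e4 N hN
  simp only [LinearMap.smul_apply, smul_eq_mul]
  field_simp
  linear_combination -this

theorem finrank_orbit_compress_le [FiniteDimensional K E] (V : Submodule K (End K E))
    (φ : Dual K E) (x y : E) (h : φ x = 1) :
    finrank K (orbit ((annihilator V x).map (compress φ x h)) (projKer φ x h y)) ≤
      finrank K (orbit (annihilator V x) y) := by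
  refine le_trans (Submodule.finrank_mono ?_)
    (Submodule.finrank_map_le (projKer φ x h) (orbit (annihilator V x) y))
  intro z hz
  obtain ⟨_, ⟨N, hN, rfl⟩, rfl⟩ := mem_orbit.1 hz
  refine ⟨N y, mem_orbit.2 ⟨N, hN, rfl⟩, ?_⟩
  ext
  rw [coe_compress_apply, coe_projKer, coe_projKer, map_sub, map_smul, (mem_annihilator.1 hN).2]
  simp

theorem NoFixedVector.exists_companion [FiniteDimensional K E]
    {V : Submodule K (End K E)} (hV : NoFixedVector V) (hmax : HasMaximalDimension V)
    {φ : Dual K E} {x y : E} (hx : IsAdapted V x) (hφ : φ x = 1)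
    (hker : ∀ z, φ z = 0 ↔ z ∈ orbit V x) (hy0 : projKer φ x hφ y ≠ 0)
    (hy : IsAdapted ((annihilator V x).map (compress φ x hφ)) (projKer φ x hφ y))
    {s : K} (hs0 : s ≠ 0) (hs1 : s ≠ 1) :
    ∃ ψ : Dual K E, ∀ N ∈ V, ψ (N y) = 0 ∧ ψ (N x) = -φ (N y) := by
  obtain ⟨h1, hmax'⟩ := hV.maximal_of_isAdapted hmax hx φ hφ
  obtain ⟨θ, hθ, -⟩ := (hV.map_compress φ x hφ).exists_dual hy0
  obtain ⟨h2, -⟩ := (hV.map_compress φ x hφ).maximal_of_isAdapted hmax' hy θ hθ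
  have h3 := finrank_orbit_compress_le V φ x y hφ
  have h4 := finrank_map_prod_eval V x y
  have h5 := finrank_ker_dual hφ
  refine hV.exists_companion_of_finrank_le hφ hker (fun c hc => hy0 ?_) (by omega) hs0 hs1
  ext
  simp [coe_projKer, hc, hφ]

/-! ### Alternating forms, invariance and polarization -/

theorem two_mul_finrank_alternatingMatrices_add_le (n : ℕ) :
    2 * finrank K (alternatingMatrices n K) + n ≤ n * n := by
  let f : Matrix (Fin n) (Fin n) K →ₗ[K] ((Σ j : Fin n, Fin (j : ℕ)) → K) :=
    { toFun := fun A p => A ⟨p.2, p.2.2.trans p.1.2⟩ p.1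
      map_add' := fun _ _ => rfl
      map_smul' := fun _ _ => rfl }
  have h1 := finrank_le_of_injOn f (alternatingMatrices n K) ⊤ (fun _ _ => trivial) (by
    rintro A ⟨hA, hA0⟩ h0
    have hlt : ∀ i j : Fin n, i < j → A i j = 0 := fun i j hij =>
      congrFun h0 ⟨j, ⟨i, hij⟩⟩
    ext i j
    rcases lt_trichotomy i j with h | rfl | h
    · exact hlt i j h
    · exact hA0 i
    · have := congrFun (congrFun hA j) i
      rw [Matrix.transpose_apply, Matrix.neg_apply, hlt j i h, neg_zero] at this
      simpa using this)
  rw [finrank_top, finrank_fintype_fun_eq_card, Fintype.card_sigma] at h1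
  simp only [Fintype.card_fin] at h1
  rw [Fin.sum_univ_eq_sum_range (fun i => i)] at h1
  have h2 := Finset.sum_range_id_mul_two n
  have h3 : n * (n - 1) + n = n * n := by
    cases n with
    | zero => rfl
    | succ k => simp; ring
  omega

/-- A space of alternating forms whose radicals all contain a subspace of codimension at most `m`
has dimension at most `m * (m - 1) / 2`. -/
theorem two_mul_finrank_add_le_of_alternating [FiniteDimensional K E]
    (U : Submodule K (E →ₗ[K] Dual K E)) (L : Submodule K E) (m : ℕ)
    (hU : ∀ b ∈ U, ∀ y, b y y = 0) (hL : ∀ b ∈ U, ∀ z ∈ L, b z = 0)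
    (hm : finrank K E ≤ finrank K L + m) : 2 * finrank K U + m ≤ m * m := by
  obtain ⟨C, hC⟩ := L.exists_isCompl
  have hk := Submodule.finrank_add_eq_of_isCompl hC
  set k := finrank K C with hkdef
  let c : Basis (Fin k) K C := finBasisOfFinrankEq K C rfl
  let f : (E →ₗ[K] Dual K E) →ₗ[K] Matrix (Fin k) (Fin k) K :=
    { toFun := fun b => Matrix.of fun i j => b (c i) (c j)
      map_add' := fun _ _ => rfl
      map_smul' := fun _ _ => rfl }
  have hswap : ∀ b ∈ U, ∀ y z, b y z = -b z y := by
    intro b hb y z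
    have := hU b hb (y + z)
    simp only [map_add, LinearMap.add_apply, hU b hb y, hU b hb z] at this
    linear_combination this
  have hmem : ∀ b ∈ U, f b ∈ alternatingMatrices k K := by
    intro b hb
    refine ⟨?_, fun i => hU b hb _⟩
    ext i j
    exact hswap b hb _ _
  have hinj : ∀ b ∈ U, f b = 0 → b = 0 := by
    intro b hb h0
    have hCC : ∀ y z : C, b y z = 0 := by
      intro y z
      have : (b.compl₁₂ C.subtype C.subtype) = 0 := by
        refine c.ext fun i => c.ext fun j => ?_
        exact congrFun (congrFun h0 i) j
      exact LinearMap.congr_fun (LinearMap.congr_fun this y) z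
    ext y z
    obtain ⟨y₁, hy₁, y₂, hy₂, rfl⟩ := Submodule.mem_sup.1
      (hC.sup_eq_top ▸ Submodule.mem_top : y ∈ L ⊔ C)
    obtain ⟨z₁, hz₁, z₂, hz₂, rfl⟩ := Submodule.mem_sup.1
      (hC.sup_eq_top ▸ Submodule.mem_top : z ∈ L ⊔ C)
    have e1 : b y₂ z₁ = 0 := by rw [hswap b hb, hL b hb z₁ hz₁]; simp
    have e2 : b y₂ z₂ = 0 := hCC ⟨y₂, hy₂⟩ ⟨z₂, hz₂⟩
    simp [hL b hb y₁ hy₁, e1, e2]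
  have h1 := finrank_le_of_injOn (F := E →ₗ[K] Dual K E) f U (alternatingMatrices k K) hmem hinj
  have h2 := two_mul_finrank_alternatingMatrices_add_le (K := K) k
  obtain ⟨d, rfl⟩ : ∃ d, m = k + d := ⟨m - k, by omega⟩
  have h3 : d ≤ d * d := Nat.le_mul_self d
  nlinarith

/-- If `V` contains every operator that vanishes on `R` and has its range in `R`, then `R` is
invariant. -/
theorem NoFixedVector.invariant_of_smulRight_mem [FiniteDimensional K E]
    {V : Submodule K (End K E)} (hV : NoFixedVector V) {R : Submodule K E}
    (hR : ∀ f : Dual K E, (∀ z ∈ R, f z = 0) → ∀ r ∈ R, f.smulRight r ∈ V) :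
    ∀ N ∈ V, ∀ r ∈ R, N r ∈ R := by
  intro N hN
  have hinj : LinearMap.ker (LinearMap.id - N) = ⊥ := by
    rw [LinearMap.ker_eq_bot']
    intro z hz
    exact hV N hN z (sub_eq_zero.1 hz).symm
  let g := LinearEquiv.ofInjectiveEndo (LinearMap.id - N) (LinearMap.ker_eq_bot.1 hinj)
  have hg : ∀ z, g z = z - N z := fun z => rfl
  -- If `z = (1 - N)⁻¹ r` lay outside `R`, a form `f` killing `R` with `f z = 1` would make `N + f ⊗
  -- r` fix `z`.
  have hle : R.map (g.symm : E →ₗ[K] E) ≤ R := by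
    rintro _ ⟨r, hr, rfl⟩
    set z := g.symm r with hz
    have hzr : z - N z = r := by rw [← hg, hz, LinearEquiv.apply_symm_apply]
    by_contra hzR
    change z ∉ R at hzR
    obtain ⟨f, hf, hfR⟩ := Submodule.exists_le_ker_of_notMem hzR
    have := hV (N + ((f z)⁻¹ • f).smulRight r) (V.add_mem hN (hR _ (fun w hw => by
      have : f w = 0 := hfR hw
      simp [this]) r hr)) z (by
      change N z + ((f z)⁻¹ * f z) • r = z
      rw [inv_mul_cancel₀ hf, one_smul, ← hzr]
      abel)
    exact hzR (this ▸ R.zero_mem)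
  have heq := Submodule.eq_of_le_of_finrank_eq hle (LinearEquiv.finrank_map_eq g.symm R)
  intro r hr
  rw [← heq] at hr
  obtain ⟨r', hr', hrr⟩ := hr
  have h1 : r - N r = r' := by rw [← hg, ← hrr]; exact g.apply_symm_apply r'
  have h2 : r ∈ R := hle ⟨r', hr', hrr⟩
  have : N r = r - r' := by rw [← h1]; abel
  rw [this]
  exact R.sub_mem h2 hr'

theorem forall_apply_eq_zero_of_notMem {G : Submodule K E} (hG : G ≠ ⊤) {F : Type*}
    [AddCommGroup F] [Module K F] {f : E →ₗ[K] F} (h : ∀ y ∉ G, f y = 0) (y : E) : f y = 0 := by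
  by_cases hy : y ∈ G
  · obtain ⟨z, -, hz⟩ := SetLike.exists_of_lt (lt_top_iff_ne_top.2 hG)
    have := h (z + y) fun hzy => hz ((Submodule.add_mem_iff_left G hy).1 hzy)
    rwa [map_add, h z hz, zero_add] at this
  · exact h y hy

/-- Over a field with at least three elements, a quadratic form that vanishes outside a proper
subspace is zero. -/
theorem forall_apply_self_eq_zero_of_notMem {G : Submodule K E} (hG : G ≠ ⊤)
    {Q : E →ₗ[K] E →ₗ[K] K} (h : ∀ y ∉ G, Q y y = 0) {s : K} (hs0 : s ≠ 0) (hs1 : s ≠ 1)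
    (y : E) : Q y y = 0 := by
  by_cases hy : y ∈ G
  -- The values at `z + y` and `z + s y` eliminate the polar term, leaving `s (s - 1) Q(y, y) = 0`.
  · obtain ⟨z, -, hz⟩ := SetLike.exists_of_lt (lt_top_iff_ne_top.2 hG)
    have h1 := h (z + y) fun hzy => hz ((Submodule.add_mem_iff_left G hy).1 hzy)
    have h2 := h (z + s • y) fun hzy =>
      hz ((Submodule.add_mem_iff_left G (G.smul_mem s hy)).1 hzy)
    simp only [map_add, map_smul, LinearMap.add_apply, LinearMap.smul_apply, smul_eq_mul,
      h z hz] at h1 h2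
    have h3 : s * (s - 1) * Q y y = 0 := by linear_combination h2 - s * h1
    simpa [hs0, sub_eq_zero, hs1] using h3
  · exact h y hy

theorem apply_self_eq_zero_of_basis {ι : Type*} [Finite ι] (e : Basis ι K E)
    (c : E →ₗ[K] E →ₗ[K] K) (h0 : ∀ i, c (e i) (e i) = 0)
    (h1 : ∀ i j, i ≠ j → c (e i) (e j) + c (e j) (e i) = 0) (y : E) : c y y = 0 := by
  classical
  have := Fintype.ofFinite ι
  have key : ∀ S : Finset ι, c (∑ i ∈ S, e.repr y i • e i) (∑ i ∈ S, e.repr y i • e i) = 0 := by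
    intro S
    induction S using Finset.induction_on with
    | empty => simp
    | insert a S ha ih =>
      have h2 : c (e a) (∑ i ∈ S, e.repr y i • e i) + c (∑ i ∈ S, e.repr y i • e i) (e a) = 0 := by
        simp only [map_sum, LinearMap.sum_apply, map_smul, LinearMap.smul_apply, smul_eq_mul]
        rw [← Finset.sum_add_distrib]
        refine Finset.sum_eq_zero fun i hi => ?_
        rw [← mul_add, h1 a i (by rintro rfl; exact ha hi), mul_zero]
      rw [Finset.sum_insert ha]
      generalize ∑ i ∈ S, e.repr y i • e i = w at *
      simp only [map_add, map_smul, LinearMap.add_apply, LinearMap.smul_apply, smul_eq_mul, ih, h0]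
      linear_combination e.repr y a * h2
  have := key Finset.univ
  rwa [e.sum_repr] at this

/-! ### Operators from `E/R` to `R` and the radical count -/

/-- Operators vanishing on `R` with range in `R`. -/
def homQuotient (R : Submodule K E) : Submodule K (End K E) where
  carrier := {N | (∀ y, N y ∈ R) ∧ ∀ z ∈ R, N z = 0}
  zero_mem' := by simp
  add_mem' := fun {a b} ha hb => ⟨fun y => R.add_mem (ha.1 y) (hb.1 y), fun z hz => by
    simp [ha.2 z hz, hb.2 z hz]⟩
  smul_mem' := fun c a ha => ⟨fun y => R.smul_mem c (ha.1 y), fun z hz => by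
    simp [ha.2 z hz]⟩

/-- The operator on `S` obtained by restricting to `S` and then applying `p`. -/
def sandwich {R S : Submodule K E} (p : E →ₗ[K] R) : End K E →ₗ[K] (S →ₗ[K] R) where
  toFun N := p ∘ₗ N ∘ₗ S.subtype
  map_add' := by intros; ext; simp
  map_smul' := by intros; ext; simp

theorem sandwich_apply {R S : Submodule K E} (p : E →ₗ[K] R) (N : End K E) (u : S) :
    sandwich p N u = p (N u) := rfl

theorem finrank_homQuotient_le [FiniteDimensional K E] (R : Submodule K E) :
    finrank K (homQuotient R) + finrank K R * finrank K R ≤ finrank K E * finrank K R := by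
  obtain ⟨C, hC⟩ := R.exists_isCompl
  obtain ⟨p, hp⟩ := R.subtype.exists_leftInverse_of_injective R.ker_subtype
  have hp' : ∀ r (hr : r ∈ R), p r = ⟨r, hr⟩ := fun r hr => LinearMap.congr_fun hp ⟨r, hr⟩
  have hinj : ∀ N ∈ homQuotient R, sandwich (S := C) p N = 0 → N = 0 := by
    rintro N ⟨h1, h2⟩ h0
    ext y
    obtain ⟨r, hr, c, hc, rfl⟩ := Submodule.mem_sup.1
      (hC.sup_eq_top ▸ Submodule.mem_top : y ∈ R ⊔ C)
    have h3 : p (N c) = 0 := LinearMap.congr_fun h0 ⟨c, hc⟩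
    rw [hp' _ (h1 c)] at h3
    have h4 : N c = 0 := congrArg Subtype.val h3
    simp [h2 r hr, h4]
  have h := finrank_le_of_injOn (sandwich (S := C) p) (homQuotient R) ⊤ (fun _ _ => trivial) hinj
  rw [finrank_top, finrank_linearMap] at h
  rw [← Submodule.finrank_add_eq_of_isCompl hC]
  linarith

/-- With `r = dim R`, restriction to `R` has image of dimension at most `r(r - 1)/2`, and its kernel
lies in `homQuotient R`, of dimension at most `r(n - r)`. The hypothesis `hdim` forces equality in
both. -/
theorem NoFixedVector.homQuotient_le_of_range_le [FiniteDimensional K E]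
    {V : Submodule K (End K E)} (hV : NoFixedVector V) {R : Submodule K E}
    (hVR : ∀ N ∈ V, ∀ y, N y ∈ R)
    (hdim : 2 * (finrank K E * finrank K R) ≤
      2 * finrank K V + finrank K R * finrank K R + finrank K R) :
    homQuotient R ≤ V := by
  obtain ⟨p, hp⟩ := R.subtype.exists_leftInverse_of_injective R.ker_subtype
  have hp' : ∀ r (hr : r ∈ R), p r = ⟨r, hr⟩ := fun r hr => LinearMap.congr_fun hp ⟨r, hr⟩
  have h1 := finrank_eq_finrank_map_add (sandwich (S := R) p) V
  have h2 : NoFixedVector (V.map (sandwich (S := R) p)) := by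
    rintro _ ⟨N, hN, rfl⟩ u hu
    rw [sandwich_apply, hp' _ (hVR N hN u)] at hu
    exact Subtype.ext (hV N hN u (congrArg Subtype.val hu))
  have h3 : 2 * finrank K (V.map (sandwich (S := R) p)) + finrank K R ≤
      finrank K R * finrank K R := h2.two_mul_finrank_add_le
  have h4 := finrank_homQuotient_le R
  have h5 : V ⊓ LinearMap.ker (sandwich (S := R) p) ≤ homQuotient R := by
    rintro N ⟨hN, h0⟩
    refine ⟨hVR N hN, fun z hz => ?_⟩
    have h1 : p (N z) = 0 := LinearMap.congr_fun h0 ⟨z, hz⟩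
    rw [hp' _ (hVR N hN z)] at h1
    exact congrArg Subtype.val h1
  have h6 := Submodule.eq_of_le_of_finrank_le h5 (by omega)
  exact h6 ▸ inf_le_left

/-- The form `(y, z) ↦ B y (N z)`. -/
def formComp (B : E →ₗ[K] Dual K E) : End K E →ₗ[K] (E →ₗ[K] Dual K E) where
  toFun N := B.compl₂ N
  map_add' := by intros; ext; simp
  map_smul' := by intros; ext; simp

theorem formComp_apply (B : E →ₗ[K] Dual K E) (N : End K E) (y z : E) :
    formComp B N y z = B y (N z) := rfl

theorem apply_eq_neg_of_alternating {c : E →ₗ[K] Dual K E} (h : ∀ y, c y y = 0) (y z : E) :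
    c y z = -c z y := by
  have := h (y + z)
  simp only [map_add, LinearMap.add_apply, h y, h z] at this
  linear_combination this

/-- `B` has rank at most `m`, so the alternating forms `formComp B N` share the radical vectors `ker
B`, of codimension at most `m`. -/
theorem two_mul_finrank_add_le_of_formComp [FiniteDimensional K E] {V : Submodule K (End K E)}
    {B : E →ₗ[K] Dual K E} (hB : ∀ N ∈ V, ∀ y, B y (N y) = 0) {S : Submodule K E}
    (hS : ∀ y, ∀ z ∈ S, B y z = 0) {m : ℕ} (hm : finrank K S + m = finrank K E) :
    2 * finrank K V + m ≤
      m * m + 2 * finrank K (V ⊓ LinearMap.ker (formComp B) : Submodule K (End K E)) := by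
  have h1 := finrank_eq_finrank_map_add (G := E →ₗ[K] Dual K E) (formComp B) V
  have h2 : 2 * finrank K (V.map (formComp B)) + m ≤ m * m := by
    refine two_mul_finrank_add_le_of_alternating _ (LinearMap.ker B) _ ?_ ?_ ?_
    · rintro _ ⟨N, hN, rfl⟩ y
      exact hB N hN y
    · rintro _ ⟨N, hN, rfl⟩ z hz
      ext y
      rw [formComp_apply, LinearMap.mem_ker.1 hz]
      rfl
    · have b3 : LinearMap.range B ≤ S.dualAnnihilator := by
        rintro _ ⟨y, rfl⟩
        rw [Submodule.mem_dualAnnihilator]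
        exact hS y
      have b4 := Submodule.finrank_mono b3
      have b5 := Subspace.finrank_add_finrank_dualAnnihilator_eq S
      have b6 := B.finrank_range_add_finrank_ker
      omega
  omega

/-- The dimension count behind the nondegeneracy of `B`: in a space of maximal dimension, the
right radical `R` of `B` in the kernel of `φ` is such that `V` contains every operator that
vanishes on `R` and has its range in `R`. -/
theorem NoFixedVector.homQuotient_le_of_radical [FiniteDimensional K E]
    {V : Submodule K (End K E)} (hV : NoFixedVector V) (hmax : HasMaximalDimension V)
    {φ : Dual K E} {x : E} (hφ : φ x = 1) (hker : ∀ z, φ z = 0 ↔ z ∈ orbit V x)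
    (B : E →ₗ[K] Dual K E) (hBx : ∀ y, B y x = 0) (R : Submodule K E)
    (hR : ∀ z, z ∈ R ↔ φ z = 0 ∧ ∀ y, B y z = 0)
    (hVR : ∀ N ∈ V, N x ∈ R → ∀ y, B y (N y) = 0 ∧ φ (N y) = 0) :
    homQuotient R ≤ V := by
  let f₀ : End K E →ₗ[K] E ⧸ R := R.mkQ ∘ₗ LinearMap.applyₗ x
  have m₁ : ∀ N ∈ V ⊓ LinearMap.ker f₀, N ∈ V ∧ ∀ y, B y (N y) = 0 ∧ φ (N y) = 0 := by
    rintro N ⟨hN, h0⟩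
    exact ⟨hN, hVR N hN ((Submodule.Quotient.mk_eq_zero R).1 h0)⟩
  have d₀ := finrank_eq_finrank_map_add f₀ V
  have hRφ : R ≤ LinearMap.ker φ := fun z hz => ((hR z).1 hz).1
  have hkφ := finrank_ker_dual hφ
  have e₀ : finrank K R + 1 + finrank K (V.map f₀) = finrank K E := by
    have a1 : V.map f₀ = (LinearMap.ker φ).map R.mkQ := by
      rw [Submodule.map_comp]
      congr 1
      ext z
      exact (hker z).symm
    have a2 := finrank_eq_finrank_map_add R.mkQ (LinearMap.ker φ)
    rw [Submodule.ker_mkQ, inf_eq_right.2 hRφ] at a2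
    rw [a1]
    omega
  have hxR : x ∉ R := fun h => by simpa [hφ] using hRφ h
  have hS : finrank K (R ⊔ Submodule.span K {x} : Submodule K E) = finrank K R + 1 := by
    refine Submodule.finrank_sup_span_singleton hxR
  have e₁ := two_mul_finrank_add_le_of_formComp (V := V ⊓ LinearMap.ker f₀)
    (fun N hN y => ((m₁ N hN).2 y).1) (S := R ⊔ Submodule.span K {x}) (by
      intro y w hw
      obtain ⟨r, hr, w', hw', rfl⟩ := Submodule.mem_sup.1 hw
      obtain ⟨c, rfl⟩ := Submodule.mem_span_singleton.1 hw'
      simp [hBx, ((hR r).1 hr).2 y]) (hS ▸ e₀)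
  have hle : V ⊓ LinearMap.ker f₀ ⊓ LinearMap.ker (formComp B) ≤ V :=
    inf_le_left.trans inf_le_left
  refine le_trans (NoFixedVector.homQuotient_le_of_range_le (fun N hN => hV N (hle hN)) ?_ ?_) hle
  · rintro N ⟨hN, h0⟩ y
    refine (hR _).2 ⟨((m₁ N hN).2 y).2, fun z => ?_⟩
    exact LinearMap.congr_fun (LinearMap.congr_fun h0 z) y
  -- With `r = dim R` and `n = r + 1 + m`, what remains is `n(n - 1)/2 - m - m(m - 1)/2 = rm + r(r +
  -- 1)/2`, exactly the threshold of `hdim`.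
  · unfold HasMaximalDimension at hmax
    rw [d₀, ← e₀] at hmax
    rw [← e₀]
    generalize finrank K (V.map f₀) = m at *
    nlinarith

/-! ### Construction of the nondegenerate form -/

/-- The form `B` determined by `B y x = 0` and `B y (N x) = -φ (N y)` for all `N ∈ V`. -/
theorem exists_form {V : Submodule K (End K E)} {φ : Dual K E} {x : E}
    (hφ : φ x = 1) (hker : ∀ z, φ z = 0 ↔ z ∈ orbit V x)
    (hann : ∀ N ∈ annihilator V x, ∀ y, φ (N y) = 0) :
    ∃ B : E →ₗ[K] Dual K E, (∀ y, B y x = 0) ∧ ∀ N ∈ V, ∀ y, B y (N x) = -φ (N y) := by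
  obtain ⟨σ, hσ⟩ := LinearMap.exists_rightInverse_of_surjective
    (LinearMap.submoduleMap (LinearMap.applyₗ x) V) (LinearMap.range_eq_top.2 (LinearMap.submoduleMap_surjective _ _))
  -- A linear choice of operators with `A z x = z - φ z • x`; by `hann`, `φ ∘ A z` does not depend
  -- on the choice.
  let A : E →ₗ[K] V := σ ∘ₗ (LinearMap.id - φ.smulRight x).codRestrict (orbit V x)
    fun z => (hker _).1 (by simp [hφ])
  have hA : ∀ z, (A z : End K E) x = z - φ z • x := fun z =>
    congrArg Subtype.val (LinearMap.congr_fun hσ _)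
  refine ⟨LinearMap.mk₂ K (fun y z => -φ ((A z : End K E) y)) ?_ ?_ ?_ ?_, fun y => ?_,
    fun N hN y => ?_⟩
  · intros; simp; ring
  · intros; simp
  · intros; simp; ring
  · intros; simp
  · have h := hann (A x) (mem_annihilator.2 ⟨(A x).2, by simp [hA, hφ]⟩) y
    simp [h]
  · have h0 : φ (N x) = 0 := (hker _).2 (mem_orbit.2 ⟨N, hN, rfl⟩)
    have h := hann (A (N x) - N) (mem_annihilator.2 ⟨V.sub_mem (A _).2 hN, by
      simp [hA, h0]⟩) y
    rw [LinearMap.sub_apply, map_sub, sub_eq_zero] at h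
    simp [h]

/-- The coefficients `λ` in `B y + λ φ` are additive. -/
theorem add_companion_of_linearIndependent {V : Submodule K (End K E)} {φ : Dual K E}
    {B : E →ₗ[K] Dual K E} {y z : E} {ly lz l₁ l₂ s : K} (hs0 : s ≠ 0) (hs1 : s ≠ 1)
    (hind : ∀ a b : K, (∀ N ∈ V, a * φ (N y) + b * φ (N z) = 0) → a = 0 ∧ b = 0)
    (hy : ∀ N ∈ V, B y (N y) + ly * φ (N y) = 0) (hz : ∀ N ∈ V, B z (N z) + lz * φ (N z) = 0)
    (h₁ : ∀ N ∈ V, B (y + z) (N (y + z)) + l₁ * φ (N (y + z)) = 0)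
    (h₂ : ∀ N ∈ V, B (y + s • z) (N (y + s • z)) + l₂ * φ (N (y + s • z)) = 0) :
    ∀ N ∈ V, B y (N z) + B z (N y) + lz * φ (N y) + ly * φ (N z) = 0 := by
  simp only [map_add, map_smul, LinearMap.add_apply, LinearMap.smul_apply, smul_eq_mul] at h₁ h₂
  -- Comparing the relations at `y + z` and `y + s z` cancels the mixed term.
  obtain ⟨ha, hb⟩ := hind (-s * ly + ly + s * l₁ - l₂) (-s * lz + s ^ 2 * lz + s * l₁ - s * l₂)
    fun N hN => by
      linear_combination s * h₁ N hN - h₂ N hN - s * hy N hN - s * hz N hN + hy N hN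
        + s ^ 2 * hz N hN
  have hs1' : s - 1 ≠ 0 := sub_ne_zero.2 hs1
  have hb' : -lz + s * lz + l₁ - l₂ = 0 := by
    refine mul_left_cancel₀ hs0 ?_
    linear_combination hb
  have hl : l₁ = ly + lz := by
    refine mul_left_cancel₀ hs1' ?_
    linear_combination ha - hb'
  subst hl
  intro N hN
  linear_combination h₁ N hN - hy N hN - hz N hN

theorem NoFixedVector.exists_alternating_form [FiniteDimensional K E]
    {V : Submodule K (End K E)} (hV : NoFixedVector V) (hmax : HasMaximalDimension V)
    (hirr : ∀ W : Submodule K E, (∀ N ∈ V, ∀ w ∈ W, N w ∈ W) → W = ⊥ ∨ W = ⊤)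
    (hn : 2 ≤ finrank K E) {s : K} (hs0 : s ≠ 0) (hs1 : s ≠ 1) :
    ∃ b : E →ₗ[K] Dual K E, LinearMap.ker b = ⊥ ∧ ∀ N ∈ V, ∀ y, b y (N y) = 0 := by
  have : Nontrivial E := nontrivial_of_finrank_pos (R := K) (by omega)
  obtain ⟨G₀, hG₀, hG₀V⟩ := hV.exists_adapted_subspace
  obtain ⟨x, -, hxG⟩ := SetLike.exists_of_lt (lt_top_iff_ne_top.2 hG₀)
  have hx := hG₀V x hxG
  have hx0 : x ≠ 0 := by rintro rfl; exact hxG G₀.zero_mem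
  obtain ⟨φ, hφ, hφV⟩ := hV.exists_dual hx0
  have hkφ := finrank_ker_dual hφ
  obtain ⟨horb, -⟩ := hV.maximal_of_isAdapted hmax hx φ hφ
  have hker : ∀ z, φ z = 0 ↔ z ∈ orbit V x := by
    have hle : orbit V x ≤ LinearMap.ker φ := fun z hz => by
      obtain ⟨N, hN, rfl⟩ := mem_orbit.1 hz
      exact hφV N hN
    have := Submodule.eq_of_le_of_finrank_eq hle (by omega)
    intro z
    rw [this]
    rfl
  have hdecomp : ∀ z, z = φ z • x + projKer φ x hφ z := fun z => by simp [coe_projKer]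
  have : Nontrivial (LinearMap.ker φ) := nontrivial_of_finrank_pos (R := K) (by omega)
  obtain ⟨G₁, hG₁, hG₁V⟩ := (hV.map_compress φ x hφ).exists_adapted_subspace
  set G := G₁.comap (projKer φ x hφ) with hGdef
  have hproj : ∀ z : LinearMap.ker φ, projKer φ x hφ z = z := fun z => by
    ext
    simp [coe_projKer]
  have hG : G ≠ ⊤ := by
    obtain ⟨z, -, hz⟩ := SetLike.exists_of_lt (lt_top_iff_ne_top.2 hG₁)
    intro h
    refine hz ?_
    have : (z : E) ∈ G := h ▸ Submodule.mem_top
    rwa [hGdef, Submodule.mem_comap, hproj] at this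
  have hcomp : ∀ y ∉ G, ∃ ψ : Dual K E, ∀ N ∈ V, ψ (N y) = 0 ∧ ψ (N x) = -φ (N y) := by
    intro y hy
    refine hV.exists_companion hmax hx hφ hker (fun h => hy ?_) (hG₁V _ hy) hs0 hs1
    rw [hGdef, Submodule.mem_comap, h]
    exact G₁.zero_mem
  have hann : ∀ N ∈ annihilator V x, ∀ y, φ (N y) = 0 := by
    intro N hN
    obtain ⟨hNV, hNx⟩ := mem_annihilator.1 hN
    refine forall_apply_eq_zero_of_notMem (f := φ ∘ₗ N) hG fun y hy => ?_
    obtain ⟨ψ, hψ⟩ := hcomp y hy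
    simpa [hNx] using (hψ N hNV).2
  obtain ⟨B, hBx, hB⟩ := exists_form hφ hker hann
  have hBx' : B x = 0 := by
    ext z
    rw [hdecomp z, map_add, map_smul, hBx]
    obtain ⟨N, hN, hNz⟩ := mem_orbit.1 ((hker _).1 (projKer φ x hφ z).2)
    rw [← hNz, hB N hN, hφV N hN]
    simp
  have hstar : ∀ y, (∃ ψ : Dual K E, ∀ N ∈ V, ψ (N y) = 0 ∧ ψ (N x) = -φ (N y)) →
      ∃ l : K, ∀ N ∈ V, B y (N y) + l * φ (N y) = 0 := by
    rintro y ⟨ψ, hψ⟩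
    -- `ψ` and `B y` agree on `Vx`, so `ψ = B y + ψ x • φ`.
    refine ⟨ψ x, fun N hN => ?_⟩
    obtain ⟨M, hM, hMz⟩ := mem_orbit.1 ((hker _).1 (projKer φ x hφ (N y)).2)
    have h1 : B y (N y) = -φ (M y) := by
      conv_lhs => rw [hdecomp (N y)]
      rw [map_add, map_smul, hBx, ← hMz, hB M hM]
      simp
    have h2 := (hψ N hN).1
    rw [hdecomp (N y), map_add, map_smul, ← hMz, (hψ M hM).2, smul_eq_mul] at h2
    rw [h1]
    linear_combination h2
  let R : Submodule K E := LinearMap.ker φ ⊓ LinearMap.ker B.flip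
  have hR : ∀ z, z ∈ R ↔ φ z = 0 ∧ ∀ y, B y z = 0 := by
    intro z
    refine and_congr Iff.rfl ?_
    exact LinearMap.ext_iff (f := B.flip z) (g := 0)
  have hVR : ∀ N ∈ V, N x ∈ R → ∀ y, B y (N y) = 0 ∧ φ (N y) = 0 := by
    intro N hN hNR
    have h1 : ∀ y, φ (N y) = 0 := fun y => by
      have := hB N hN y
      rw [((hR _).1 hNR).2 y] at this
      exact neg_eq_zero.1 this.symm
    refine fun y => ⟨?_, h1 y⟩
    refine forall_apply_self_eq_zero_of_notMem (Q := formComp B N) hG (fun z hz => ?_) hs0 hs1 y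
    obtain ⟨l, hl⟩ := hstar z (hcomp z hz)
    simpa [h1, formComp_apply] using hl N hN
  have hRbot : R = ⊥ := by
    refine (hirr R (hV.invariant_of_smulRight_mem fun f hf r hr => ?_)).resolve_right fun h => ?_
    · exact hV.homQuotient_le_of_radical hmax hφ hker B hBx R hR hVR
        ⟨fun y => R.smul_mem _ hr, fun z hz => by simp [hf z hz]⟩
    · have := ((hR x).1 (h ▸ Submodule.mem_top)).1
      rw [hφ] at this
      exact one_ne_zero this
  -- A rank-one `f ⊗ ȳ` in the compression gives `f z * B(z, ȳ) = 0`. So `B(z, ȳ)` vanishes off `ker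
  -- f`, hence everywhere, and `ȳ` lies in `R = 0`.
  have hadapt : ∀ y, projKer φ x hφ y ≠ 0 →
      IsAdapted ((annihilator V x).map (compress φ x hφ)) (projKer φ x hφ y) := by
    rintro y hy f ⟨N, hN, hNf⟩
    by_contra hf
    obtain ⟨hNV, hNx⟩ := mem_annihilator.1 hN
    have h1 := hVR N hNV (by rw [hNx]; exact R.zero_mem)
    have h2 : ∀ z : LinearMap.ker φ, N z = f z • (projKer φ x hφ y : E) := by
      intro z
      have := congrArg Subtype.val (LinearMap.congr_fun hNf z)
      rw [coe_compress_apply, (h1 z).2, zero_smul, sub_zero] at this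
      exact this
    have hker' : LinearMap.ker f ≠ ⊤ := fun h => hf (LinearMap.ker_eq_top.1 h)
    have h3 := forall_apply_eq_zero_of_notMem hker'
      (f := B.flip (projKer φ x hφ y) ∘ₗ (LinearMap.ker φ).subtype) (fun z hz => by
        have := (h1 z).1
        rw [h2, map_smul, smul_eq_mul] at this
        exact (mul_eq_zero.1 this).resolve_left hz)
    have h4 : (projKer φ x hφ y : E) ∈ R := by
      refine (hR _).2 ⟨(projKer φ x hφ y).2, fun z => ?_⟩
      rw [hdecomp z, map_add, map_smul, hBx']
      simpa using h3 (projKer φ x hφ z)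
    rw [hRbot, Submodule.mem_bot] at h4
    exact hy (Subtype.ext h4)
  have hall : ∀ y, ∃ l : K, ∀ N ∈ V, B y (N y) + l * φ (N y) = 0 := by
    intro y
    by_cases hy : projKer φ x hφ y = 0
    · refine ⟨0, fun N hN => ?_⟩
      rw [show B y = 0 by rw [hdecomp y, hy]; simp [hBx']]
      simp
    · exact hstar y (hV.exists_companion hmax hx hφ hker hy (hadapt y hy) hs0 hs1)
  choose l hl using hall
  -- Since `R = 0`, `B` is nondegenerate on `ker φ`, and `φ (N y) = -B(y, Nx)`.
  have hBinj : ∀ y : LinearMap.ker φ, (∀ N ∈ V, φ (N y) = 0) → y = 0 := by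
    intro y hy
    let B' := B.compl₁₂ (LinearMap.ker φ).subtype (LinearMap.ker φ).subtype
    have hinj : Function.Injective B'.flip := by
      refine LinearMap.ker_eq_bot.1 (LinearMap.ker_eq_bot'.2 fun z hz => ?_)
      have : (z : E) ∈ R := by
        refine (hR _).2 ⟨z.2, fun w => ?_⟩
        rw [hdecomp w, map_add, map_smul, hBx']
        have : B (projKer φ x hφ w) z = 0 := LinearMap.congr_fun hz (projKer φ x hφ w)
        simpa using this
      rw [hRbot, Submodule.mem_bot] at this
      exact Subtype.ext this
    have hsurj := (LinearMap.injective_iff_surjective_of_finrank_eq_finrank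
      Subspace.dual_finrank_eq.symm).1 hinj
    refine (Module.forall_dual_apply_eq_zero_iff K y).1 fun g => ?_
    obtain ⟨z, rfl⟩ := hsurj g
    obtain ⟨N, hN, hNz⟩ := mem_orbit.1 ((hker _).1 z.2)
    change B y z = 0
    rw [← hNz, hB N hN, hy N hN, neg_zero]
  let e := finBasis K (LinearMap.ker φ)
  -- The value `Λ x = 1` is what `b x (N z) + b z (N x) = 0` requires; on the basis, `Λ` takes the
  -- coefficients `l`.
  let Λ : Dual K E := φ + (e.constr K fun i => l (e i)) ∘ₗ projKer φ x hφ
  have hΛx : Λ x = 1 := by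
    have : projKer φ x hφ x = 0 := by ext; simp [coe_projKer, hφ]
    simp [Λ, this, hφ]
  have hΛe : ∀ i, Λ (e i) = l (e i) := by
    intro i
    simp [Λ, hproj]
  let b : E →ₗ[K] Dual K E := B + Λ.smulRight φ
  have hb : ∀ y z, b y z = B y z + Λ y * φ z := fun _ _ => rfl
  refine ⟨b, ?_, fun N hN y => ?_⟩
  · rw [LinearMap.ker_eq_bot']
    intro y hy
    have h1 : ∀ N ∈ V, φ (N y) = 0 := fun N hN => by
      have := hb y (N x)
      rw [hy, hB N hN, hφV N hN] at this
      simpa using this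
    have h2 : projKer φ x hφ y = 0 := hBinj _ fun N hN => by
      have := h1 N hN
      rw [hdecomp y, map_add, map_add, map_smul, map_smul, hφV N hN] at this
      simpa using this
    have h3 : y = φ y • x := by
      conv_lhs => rw [hdecomp y, h2]
      simp
    have h4 := hb y x
    rw [hy, hBx, h3, map_smul, hΛx, hφ] at h4
    rw [h3, show φ y = 0 by simpa using h4.symm, zero_smul]
  · have hsymm : ∀ z : LinearMap.ker φ, b x (N z) + b z (N x) = 0 := by
      intro z
      rw [hb, hb, hBx', hΛx, hB N hN, hφV N hN]
      simp
    have hH : ∀ z : LinearMap.ker φ, b z (N z) = 0 := by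
      refine apply_self_eq_zero_of_basis e
        ((formComp b N).compl₁₂ (LinearMap.ker φ).subtype (LinearMap.ker φ).subtype) ?_ ?_
      · intro i
        change b (e i) (N (e i)) = 0
        rw [hb, hΛe, hl _ N hN]
      · intro i j hij
        change b (e i) (N (e j)) + b (e j) (N (e i)) = 0
        rw [hb, hb, hΛe, hΛe]
        have := add_companion_of_linearIndependent (y := (e i : E)) (z := e j) hs0 hs1 (by
          intro a c hac
          have h0 := hBinj (a • e i + c • e j) fun N hN => by simpa using hac N hN
          have hi := congrArg (fun w => e.repr w i) h0
          have hj := congrArg (fun w => e.repr w j) h0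
          simp only [map_add, map_smul, e.repr_self, map_zero] at hi hj
          exact ⟨by simpa [Finsupp.single_apply, hij.symm] using hi,
            by simpa [Finsupp.single_apply, hij] using hj⟩) (hl _) (hl _) (hl _) (hl _) N hN
        linear_combination this
    rw [hdecomp y]
    have h1 := hsymm (projKer φ x hφ y)
    have h2 := hH (projKer φ x hφ y)
    have h3 : b x (N x) = 0 := by rw [hb, hBx', hφV N hN]; simp
    simp only [map_add, map_smul, LinearMap.add_apply, LinearMap.smul_apply, smul_eq_mul]
    linear_combination φ y * h1 + h2 + φ y * φ y * h3

end

/-! ### Return to matrices -/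

theorem HasTrivialSpectrum.noFixedVector {K : Type*} [Field K] {n : ℕ}
    {V : Submodule K (Matrix (Fin n) (Fin n) K)} (hV : TrivialSpectrum.HasTrivialSpectrum V) :
    NoFixedVector (V.map (Matrix.toLin' : Matrix (Fin n) (Fin n) K ≃ₗ[K] _).toLinearMap) := by
  rintro _ ⟨N, hN, rfl⟩ x hx
  by_contra h0
  exact one_ne_zero (hV N hN 1 (Module.End.hasEigenvalue_of_hasEigenvector (x := x)
    ⟨Module.End.mem_eigenspace_iff.2 (by simpa using hx), h0⟩))

theorem exists_ne_zero_ne_one {K : Type*} [Field K] (h : 3 ≤ Cardinal.mk K) :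
    ∃ s : K, s ≠ 0 ∧ s ≠ 1 := by
  classical
  by_contra! hc
  have h1 : (Set.univ : Set K) ⊆ ((({0, 1} : Finset K) : Set K)) := fun s _ => by
    by_cases hs : s = 0
    · simp [hs]
    · simp [hc s hs]
  have h2 := Cardinal.mk_le_mk_of_subset h1
  rw [Cardinal.mk_univ] at h2
  replace h2 := h2.trans_eq (Cardinal.mk_coe_finset (s := ({0, 1} : Finset K)))
  have h3 := h.trans h2
  have h4 : (({0, 1} : Finset K)).card ≤ 2 := Finset.card_le_two
  have h5 : 3 ≤ ({0, 1} : Finset K).card := by exact_mod_cast h3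
  omega

theorem two_mul_mul_pred_half_add (n : ℕ) : 2 * (n * (n - 1) / 2) + n = n * n := by
  rw [Nat.mul_div_cancel' (Nat.even_mul_pred_self n).two_dvd]
  cases n with
  | zero => rfl
  | succ k => simp; ring

theorem HasTrivialSpectrum.finrank_le {K : Type*} [Field K] {n : ℕ}
    {V : Submodule K (Matrix (Fin n) (Fin n) K)} (hV : HasTrivialSpectrum V) :
    finrank K V ≤ n * (n - 1) / 2 := by
  have h := hV.noFixedVector.two_mul_finrank_add_le
  rw [LinearEquiv.finrank_map_eq, finrank_fin_fun] at h
  have := two_mul_mul_pred_half_add n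
  omega

/-- An irreducible space of matrices with trivial spectrum and maximal dimension is equivalent to
the space of alternating matrices. -/
theorem HasTrivialSpectrum.exists_eq_mul_alternatingMatrices {K : Type*} [Field K] {n : ℕ}
    {V : Submodule K (Matrix (Fin n) (Fin n) K)} (hV : HasTrivialSpectrum V)
    (heq : finrank K V = n * (n - 1) / 2) (hK : 3 ≤ Cardinal.mk K) (hirr : IsIrreducible V) :
    ∃ P : GL (Fin n) K, (V : Set (Matrix (Fin n) (Fin n) K)) =
      (fun A : Matrix (Fin n) (Fin n) K => (P : Matrix (Fin n) (Fin n) K) * A) ''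
        (alternatingMatrices n K : Set (Matrix (Fin n) (Fin n) K)) := by
  classical
  have hV' := hV.noFixedVector
  set V' := V.map (Matrix.toLin' : Matrix (Fin n) (Fin n) K ≃ₗ[K] _).toLinearMap with hV'def
  have hdim : finrank K V' = finrank K V := LinearEquiv.finrank_map_eq _ _
  have hnn := two_mul_mul_pred_half_add n
  have halt := two_mul_finrank_alternatingMatrices_add_le (K := K) n
  suffices h : ∃ Q : Matrix (Fin n) (Fin n) K, IsUnit Q ∧
      ∀ N ∈ V, Q * N ∈ alternatingMatrices n K by
    obtain ⟨_, ⟨Q, rfl⟩, hQ⟩ := h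
    have hle : V.map (LinearMap.mulLeft K (Q : Matrix (Fin n) (Fin n) K)) ≤
        alternatingMatrices n K := by
      rintro _ ⟨N, hN, rfl⟩
      exact hQ N hN
    have hfr := finrank_le_of_injOn (LinearMap.mulLeft K (Q : Matrix (Fin n) (Fin n) K)) V
      (V.map (LinearMap.mulLeft K (Q : Matrix (Fin n) (Fin n) K)))
      (fun N hN => Submodule.mem_map_of_mem hN) fun N _ h0 => by
        have h1 : (Q : Matrix (Fin n) (Fin n) K) * N = 0 := h0
        simpa using congrArg
          (fun M => ((Q⁻¹ : (Matrix (Fin n) (Fin n) K)ˣ) : Matrix (Fin n) (Fin n) K) * M) h1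
    have hmap := Submodule.eq_of_le_of_finrank_le hle (by omega)
    refine ⟨Q⁻¹, Set.ext fun N => ⟨fun hN => ⟨_, hQ N hN, by simp⟩, ?_⟩⟩
    rintro ⟨A, hA, rfl⟩
    rw [SetLike.mem_coe, ← hmap] at hA
    obtain ⟨N, hN, rfl⟩ := hA
    simpa using hN
  rcases Nat.lt_or_ge n 2 with hn | hn
  -- For `n < 2` the space `V` is zero; the construction of `b` needs `ker φ ≠ 0`.
  · refine ⟨1, isUnit_one, fun N hN => ?_⟩
    have h0 : finrank K V = 0 := by
      rw [heq]
      interval_cases n <;> rfl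
    rw [Submodule.finrank_eq_zero] at h0
    rw [h0, Submodule.mem_bot] at hN
    rw [hN, mul_zero]
    exact Submodule.zero_mem _
  obtain ⟨s, hs0, hs1⟩ := exists_ne_zero_ne_one hK
  obtain ⟨b, hb, hbV⟩ := hV'.exists_alternating_form
    (by unfold HasMaximalDimension; rw [hdim, finrank_fin_fun]; omega)
    (fun W hW => hirr W fun N hN w hw => by
      simpa using hW (Matrix.toLin' N) (Submodule.mem_map_of_mem hN) w hw)
    (by rwa [finrank_fin_fun]) hs0 hs1
  have hbQ : ∀ y z : Fin n → K, b y z = dotProduct y (Matrix.mulVec (LinearMap.toMatrix₂' K b) z) :=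
    fun y z => by
      rw [← Matrix.toLinearMap₂'_apply', Matrix.toLinearMap₂'_toMatrix']
  refine ⟨LinearMap.toMatrix₂' K b, ?_, fun N hN => ?_⟩
  · refine Matrix.vecMul_injective_iff_isUnit.1 fun y y' hyy => LinearMap.ker_eq_bot.1 hb ?_
    refine LinearMap.ext fun z => ?_
    rw [hbQ, hbQ, Matrix.dotProduct_mulVec, Matrix.dotProduct_mulVec]
    exact congrArg (fun w => dotProduct w z) hyy
  · have hN' : ∀ y, formComp b (Matrix.toLin' N) y y = 0 :=
      hbV (Matrix.toLin' N) (Submodule.mem_map_of_mem hN)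
    have hent : ∀ i j, (LinearMap.toMatrix₂' K b * N) i j =
        formComp b (Matrix.toLin' N) (Pi.single i 1) (Pi.single j 1) := by
      intro i j
      rw [formComp_apply, hbQ, Matrix.toLin'_apply, Matrix.mulVec_mulVec]
      simp
    refine ⟨?_, fun i => by rw [hent, hN']⟩
    ext i j
    rw [Matrix.transpose_apply, Matrix.neg_apply, hent, hent]
    exact apply_eq_neg_of_alternating hN' _ _

end TrivialSpectrum

theorem theorem2 {K : Type*} [Field K] (n : ℕ)
    (V : Submodule K (Matrix (Fin n) (Fin n) K))
    (hV : TrivialSpectrum.HasTrivialSpectrum V) :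
    Module.finrank K V ≤ n * (n - 1) / 2 ∧
    (Module.finrank K V = n * (n - 1) / 2 → 3 ≤ Cardinal.mk K →
      TrivialSpectrum.IsIrreducible V →
      ∃ P : GL (Fin n) K,
        (V : Set (Matrix (Fin n) (Fin n) K)) =
          (fun A : Matrix (Fin n) (Fin n) K => (P : Matrix (Fin n) (Fin n) K) * A) ''
            (TrivialSpectrum.alternatingMatrices n K : Set (Matrix (Fin n) (Fin n) K))) :=
  ⟨hV.finrank_le, hV.exists_eq_mul_alternatingMatrices⟩
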